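/- All spaces and operators are real. For Riesz spaces (vector lattices) $E,F$, a linear operator $E\to F$ is positive if it maps the positive cone of $E$ into that of $F$; let $L^r(E,F)$ be the space of regular operators (differences of two positive linear operators $E\to F$), ordered by $S\le T$ iff $T-S$ is positive. If $F$ is Dedekind complete (every nonempty subset that is bounded above has a supremum), then $L^r(E,F)$ is a Dedekind complete Riesz space; write $|T|=T\vee(-T)$ for the modulus. If $E$ and $F$ carry norms, the regular norm of $T\in L^r(E,F)$ is $\|T\|_r=\||T|\|=\sup\{\||T|x\| : x\in E,\ \|x\|\le 1\}$. The norm of a Banach lattice $E$ is order continuous if $\inf_{x\in D}\|x\|=0$ for every nonempty downward directed $D\subseteq E$ with $\inf D=0$; a Banach lattice with order continuous norm is Dedekind complete. **Corollary 2.3.** Let $W,X,Y,Z$ be Banach lattices such that $X$ and $Y$ have order continuous norms and $Z$ is Dedekind complete. For $A\in L^r(Y,Z)$ and $B\in L^r(W,X)$ let $M_{A,B}\in L^r\big(L^r(X,Y),L^r(W,Z)\big)$ be the two-sided multiplication operator $M_{A,B}(T)=ATB$, where $L^r(X,Y)$ and $L^r(W,Z)$ carry their regular norms. Then, for all $A\in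 L^r(Y,Z)$ and all $B\in L^r(W,X)$, the suprema defining $\|A\|_r$, $\|B\|_r$ and $\|M_{A,B}\|_r$ are finite and $$\|M_{A,B}\|_r=\|A\|_r\,\|B\|_r .$$ -/

import Mathlib

/-- An ordered set is Dedekind complete if every nonempty subset that is bounded above has a
supremum. -/
class DedekindComplete (E : Type*) [Preorder E] : Prop where
  exists_isLUB : ∀ s : Set E, s.Nonempty → BddAbove s → ∃ a, IsLUB s a

/-- The norm is order continuous: along every downward directed set with infimum `0` the norms
decrease to `0`. (Such a set is a decreasing net indexed by itself, and as the norm is monotone on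
the positive cone, convergence to `0` along it means that the norms get arbitrarily small.) -/
class OrderContinuousNorm (E : Type*) [NormedAddCommGroup E] [Lattice E] : Prop where
  exists_norm_lt : ∀ D : Set E, D.Nonempty → DirectedOn (fun a b => b ≤ a) D → IsGLB D 0 →
    ∀ ε : ℝ, 0 < ε → ∃ x ∈ D, ‖x‖ < ε

theorem DedekindComplete.exists_isGLB {E : Type*} [Preorder E] [DedekindComplete E] (s : Set E)
    (hs : s.Nonempty) (hb : BddBelow s) : ∃ a, IsGLB s a := by
  obtain ⟨b, hb⟩ := hb
  obtain ⟨x, hx⟩ := hs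
  obtain ⟨a, ha⟩ := DedekindComplete.exists_isLUB (lowerBounds s) ⟨b, hb⟩
    ⟨x, fun y hy => hy hx⟩
  exact ⟨a, isLUB_lowerBounds.1 ha⟩

/-- A Banach lattice with order continuous norm is Dedekind complete. -/
instance (priority := 100) OrderContinuousNorm.dedekindComplete {E : Type*}
    [NormedAddCommGroup E] [Lattice E] [HasSolidNorm E] [IsOrderedAddMonoid E] [NormedSpace ℝ E]
    [IsOrderedModule ℝ E] [CompleteSpace E] [OrderContinuousNorm E] : DedekindComplete E where
  exists_isLUB := by
    intro s hs hb
    set U := upperBounds s with hU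
    set L := lowerBounds U with hL
    have hsL : s ⊆ L := fun x hx u hu => hu hx
    obtain ⟨x₀, hx₀⟩ := hs
    obtain ⟨b, hb⟩ := hb
    have hUinf : ∀ u ∈ U, ∀ u' ∈ U, u ⊓ u' ∈ U := fun u hu u' hu' x hx =>
      le_inf (hu hx) (hu' hx)
    have hLsup : ∀ v ∈ L, ∀ v' ∈ L, v ⊔ v' ∈ L := fun v hv v' hv' u hu =>
      sup_le (hv hu) (hv' hu)
    set D : Set E := {d | ∃ u ∈ U, ∃ v ∈ L, d = u - v} with hD
    have hDne : D.Nonempty := ⟨_, b, hb, x₀, hsL hx₀, rfl⟩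
    have hDdir : DirectedOn (fun a b => b ≤ a) D := by
      rintro _ ⟨u, hu, v, hv, rfl⟩ _ ⟨u', hu', v', hv', rfl⟩
      exact ⟨_, ⟨_, hUinf u hu u' hu', _, hLsup v hv v' hv', rfl⟩,
        sub_le_sub inf_le_left le_sup_left, sub_le_sub inf_le_right le_sup_right⟩
    have hDglb : IsGLB D 0 := by
      constructor
      · rintro _ ⟨u, hu, v, hv, rfl⟩
        exact sub_nonneg.2 (hv hu)
      · intro d hd
        have hd' : ∀ v ∈ L, v + d ∈ L := fun v hv u hu => by
          have := hd ⟨u, hu, v, hv, rfl⟩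
          rwa [le_sub_iff_add_le, add_comm] at this
        have hn : ∀ n : ℕ, x₀ + n • d ∈ L := by
          intro n
          induction n with
          | zero => simpa using hsL hx₀
          | succ n ih => rw [succ_nsmul, ← add_assoc]; exact hd' _ ih
        have hle : ∀ n : ℕ, d ≤ (1 / ((n : ℝ) + 1)) • (b - x₀) := fun n => by
          have h1 : (n + 1) • d ≤ b - x₀ := by
            rw [le_sub_iff_add_le, add_comm]
            exact hn (n + 1) hb
          have hpos : (0 : ℝ) < (n : ℝ) + 1 := by positivity
          have h2 := smul_le_smul_of_nonneg_left h1 (one_div_pos.2 hpos).le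
          rw [← Nat.cast_smul_eq_nsmul ℝ, smul_smul] at h2
          have h3 : 1 / ((n : ℝ) + 1) * ((n + 1 : ℕ) : ℝ) = 1 := by
            push_cast
            field_simp
          rwa [h3, one_smul] at h2
        have hlim : Filter.Tendsto (fun n : ℕ => (1 / ((n : ℝ) + 1)) • (b - x₀)) Filter.atTop
            (nhds ((0 : ℝ) • (b - x₀))) :=
          tendsto_one_div_add_atTop_nhds_zero_nat.smul_const _
        rw [zero_smul] at hlim
        exact ge_of_tendsto' hlim hle
    have hex : ∀ n : ℕ, ∃ u ∈ U, ∃ v ∈ L, ‖u - v‖ < 1 / ((n : ℝ) + 1) := fun n => by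
      obtain ⟨_, ⟨u, hu, v, hv, rfl⟩, h⟩ := OrderContinuousNorm.exists_norm_lt D hDne hDdir hDglb
        (1 / ((n : ℝ) + 1)) (by positivity)
      exact ⟨u, hu, v, hv, h⟩
    choose u hu v hv huv using hex
    have hdist : ∀ n m, ‖v n - v m‖ ≤ 1 / ((n : ℝ) + 1) + 1 / ((m : ℝ) + 1) := fun n m => by
      have habs : |v n - v m| ≤ |(u n - v n) + (u m - v m)| := by
        have h1 : 0 ≤ u n - v n := sub_nonneg.2 (hv n (hu n))
        have h2 : 0 ≤ u m - v m := sub_nonneg.2 (hv m (hu m))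
        rw [abs_of_nonneg (add_nonneg h1 h2)]
        refine abs_le'.2 ⟨?_, ?_⟩
        · exact (sub_le_sub_right (hv n (hu m)) _).trans (le_add_of_nonneg_left h1)
        · rw [neg_sub]
          exact (sub_le_sub_right (hv m (hu n)) _).trans (le_add_of_nonneg_right h2)
      exact (norm_le_norm_of_abs_le_abs habs).trans ((norm_add_le _ _).trans
        (add_le_add (huv n).le (huv m).le))
    have hlim0 : Filter.Tendsto (fun n : ℕ => 1 / ((n : ℝ) + 1)) Filter.atTop (nhds 0) :=
      tendsto_one_div_add_atTop_nhds_zero_nat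
    have hcauchy : CauchySeq v := by
      refine Metric.cauchySeq_iff'.2 fun ε hε => ?_
      obtain ⟨N, hN⟩ := (hlim0.eventually (gt_mem_nhds (half_pos hε))).exists
      refine ⟨N, fun n hn => ?_⟩
      rw [dist_eq_norm]
      have hmono : 1 / ((n : ℝ) + 1) ≤ 1 / ((N : ℝ) + 1) :=
        one_div_le_one_div_of_le (by positivity) (by exact_mod_cast Nat.succ_le_succ hn)
      linarith [hdist n N]
    obtain ⟨l, hl⟩ := cauchySeq_tendsto_of_complete hcauchy
    have hul : Filter.Tendsto u Filter.atTop (nhds l) := by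
      have h0 : Filter.Tendsto (fun n => u n - v n) Filter.atTop (nhds 0) :=
        squeeze_zero_norm (fun n => (huv n).le) hlim0
      simpa using hl.add h0
    exact ⟨l, fun x hx => ge_of_tendsto' hul fun n => hu n hx,
      fun w hw => le_of_tendsto' hl fun n => hv n hw⟩

set_option linter.unusedSectionVars false

section RegularOperators

variable {E F G : Type*}
  [AddCommGroup E] [Lattice E] [IsOrderedAddMonoid E] [Module ℝ E] [IsOrderedModule ℝ E]
  [AddCommGroup F] [Lattice F] [IsOrderedAddMonoid F] [Module ℝ F] [IsOrderedModule ℝ F]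
  [AddCommGroup G] [Lattice G] [IsOrderedAddMonoid G] [Module ℝ G] [IsOrderedModule ℝ G]

/-- A linear operator between Riesz spaces is positive if it maps the positive cone into the
positive cone. -/
def IsPositiveOperator (T : E →ₗ[ℝ] F) : Prop :=
  ∀ x, 0 ≤ x → 0 ≤ T x

variable (E F) in
/-- The space of regular operators: differences of two positive linear operators. -/
def regularOperators : Submodule ℝ (E →ₗ[ℝ] F) where
  carrier := {T | ∃ P Q : E →ₗ[ℝ] F, IsPositiveOperator P ∧ IsPositiveOperator Q ∧ T = P - Q}
  zero_mem' := ⟨0, 0, fun _ _ => le_rfl, fun _ _ => le_rfl, (sub_zero _).symm⟩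
  add_mem' := by
    rintro _ _ ⟨P, Q, hP, hQ, rfl⟩ ⟨P', Q', hP', hQ', rfl⟩
    exact ⟨P + P', Q + Q', fun x hx => add_nonneg (hP x hx) (hP' x hx),
      fun x hx => add_nonneg (hQ x hx) (hQ' x hx), by abel⟩
  smul_mem' := by
    rintro c _ ⟨P, Q, hP, hQ, rfl⟩
    rcases le_total 0 c with hc | hc
    · exact ⟨c • P, c • Q, fun x hx => smul_nonneg hc (hP x hx),
        fun x hx => smul_nonneg hc (hQ x hx), smul_sub _ _ _⟩
    · refine ⟨(-c) • Q, (-c) • P, fun x hx => smul_nonneg (neg_nonneg.2 hc) (hQ x hx),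
        fun x hx => smul_nonneg (neg_nonneg.2 hc) (hP x hx), ?_⟩
      rw [smul_sub, neg_smul, neg_smul]
      abel

variable (E F) in
/-- The space `L^r(E, F)` of regular operators, as a type that carries the operator order. -/
def RegularOperator : Type _ := regularOperators E F

namespace RegularOperator

instance : AddCommGroup (RegularOperator E F) :=
  inferInstanceAs (AddCommGroup (regularOperators E F))

instance : Module ℝ (RegularOperator E F) := inferInstanceAs (Module ℝ (regularOperators E F))

/-- The underlying linear map of a regular operator. -/
def toLinearMap (T : RegularOperator E F) : E →ₗ[ℝ] F := T.1

instance : CoeFun (RegularOperator E F) (fun _ => E → F) := ⟨fun T => T.toLinearMap⟩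

theorem toLinearMap_add (S T : RegularOperator E F) :
    (S + T).toLinearMap = S.toLinearMap + T.toLinearMap := rfl

theorem toLinearMap_neg (T : RegularOperator E F) : (-T).toLinearMap = -T.toLinearMap := rfl

theorem toLinearMap_smul (c : ℝ) (T : RegularOperator E F) :
    (c • T).toLinearMap = c • T.toLinearMap := rfl

theorem ext_nonneg {S T : RegularOperator E F} (h : ∀ x, 0 ≤ x → S x = T x) : S = T := by
  refine Subtype.ext (LinearMap.ext fun x => ?_)
  change S.toLinearMap x = T.toLinearMap x
  rw [← posPart_sub_negPart x, map_sub, map_sub, h _ (posPart_nonneg x), h _ (negPart_nonneg x)]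

/-- The operator order: `S ≤ T` means that `T - S` is positive. -/
instance : PartialOrder (RegularOperator E F) where
  le S T := ∀ x, 0 ≤ x → S x ≤ T x
  le_refl _ _ _ := le_rfl
  le_trans _ _ _ h h' x hx := (h x hx).trans (h' x hx)
  le_antisymm _ _ h h' := ext_nonneg fun x hx => (h x hx).antisymm (h' x hx)

theorem le_def {S T : RegularOperator E F} : S ≤ T ↔ ∀ x, 0 ≤ x → S x ≤ T x := Iff.rfl

instance : IsOrderedAddMonoid (RegularOperator E F) where
  add_le_add_left _ _ h c x hx := add_le_add_left (h x hx) (c x)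

instance : IsOrderedModule ℝ (RegularOperator E F) where
  smul_le_smul_of_nonneg_left _ hc _ _ h x hx := smul_le_smul_of_nonneg_left (h x hx) hc
  smul_le_smul_of_nonneg_right _ hT _ _ hc x hx := smul_le_smul_of_nonneg_right hc (hT x hx)

/-- An additive, positively homogeneous map on the positive cone extends to a linear map. -/
theorem exists_linearMap_extension (p : E → F)
    (hadd : ∀ x y, 0 ≤ x → 0 ≤ y → p (x + y) = p x + p y)
    (hsmul : ∀ (c : ℝ) (x : E), 0 ≤ c → 0 ≤ x → p (c • x) = c • p x) :
    ∃ L : E →ₗ[ℝ] F, ∀ x, 0 ≤ x → L x = p x := by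
  have hp0 : p 0 = 0 := by simpa using hsmul 0 0 le_rfl le_rfl
  have key : ∀ x a b : E, 0 ≤ a → 0 ≤ b → x = a - b → p x⁺ - p x⁻ = p a - p b := by
    rintro x a b ha hb rfl
    have h : (a - b)⁺ + b = (a - b)⁻ + a := by
      have h' := posPart_sub_negPart (a - b)
      rw [sub_eq_sub_iff_add_eq_add] at h'
      rw [h', add_comm]
    have h' := congrArg p h
    rw [hadd _ _ (posPart_nonneg _) hb, hadd _ _ (negPart_nonneg _) ha] at h'
    rw [sub_eq_sub_iff_add_eq_add, h', add_comm]
  refine ⟨{ toFun := fun x => p x⁺ - p x⁻, map_add' := fun x y => ?_, map_smul' := fun c x => ?_ },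
    fun x hx => ?_⟩
  · rw [key (x + y) (x⁺ + y⁺) (x⁻ + y⁻) (add_nonneg (posPart_nonneg _) (posPart_nonneg _))
      (add_nonneg (negPart_nonneg _) (negPart_nonneg _)),
      hadd _ _ (posPart_nonneg _) (posPart_nonneg _),
      hadd _ _ (negPart_nonneg _) (negPart_nonneg _)]
    · abel
    · conv_lhs => rw [← posPart_sub_negPart x, ← posPart_sub_negPart y]
      abel
  · rw [RingHom.id_apply]
    rcases le_total 0 c with hc | hc
    · rw [key (c • x) (c • x⁺) (c • x⁻) (smul_nonneg hc (posPart_nonneg _))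
        (smul_nonneg hc (negPart_nonneg _)), hsmul _ _ hc (posPart_nonneg _),
        hsmul _ _ hc (negPart_nonneg _), smul_sub]
      rw [← smul_sub, posPart_sub_negPart]
    · have hc' := neg_nonneg.2 hc
      rw [key (c • x) ((-c) • x⁻) ((-c) • x⁺) (smul_nonneg hc' (negPart_nonneg _))
        (smul_nonneg hc' (posPart_nonneg _)), hsmul _ _ hc' (posPart_nonneg _),
        hsmul _ _ hc' (negPart_nonneg _), smul_sub, neg_smul, neg_smul]
      · abel
      · rw [← smul_sub, neg_smul, ← smul_neg, neg_sub, posPart_sub_negPart]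
  · change p x⁺ - p x⁻ = p x
    rw [key x x 0 hx le_rfl (sub_zero x).symm, hp0, sub_zero]

/-- A linear map that dominates a regular operator is regular. -/
theorem exists_toLinearMap_eq (T : RegularOperator E F) (L : E →ₗ[ℝ] F)
    (h : ∀ x, 0 ≤ x → T x ≤ L x) : ∃ S : RegularOperator E F, S.toLinearMap = L := by
  obtain ⟨P, Q, hP, hQ, hT⟩ := T.2
  have hT' : T.toLinearMap = P - Q := hT
  refine ⟨⟨L, (L - T.toLinearMap) + P, Q,
    fun x hx => add_nonneg (sub_nonneg.2 (h x hx)) (hP x hx), hQ, ?_⟩, rfl⟩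
  rw [hT']
  abel

/-- Every regular operator lies below a positive one. -/
theorem exists_nonneg_ge (T : RegularOperator E F) : ∃ P : RegularOperator E F, 0 ≤ P ∧ T ≤ P := by
  obtain ⟨P, Q, hP, hQ, hT⟩ := T.2
  have hT' : T.toLinearMap = P - Q := hT
  refine ⟨⟨P, P, 0, hP, fun _ _ => le_rfl, (sub_zero P).symm⟩, hP, fun x hx => ?_⟩
  rw [hT']
  exact sub_le_self _ (hQ x hx)

theorem isLUB_smul_pos {s : Set F} {a : F} (h : IsLUB s a) {c : ℝ} (hc : 0 < c) :
    IsLUB ((fun y => c • y) '' s) (c • a) := by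
  constructor
  · rintro _ ⟨y, hy, rfl⟩
    exact smul_le_smul_of_nonneg_left (h.1 hy) hc.le
  · intro b hb
    have : a ≤ c⁻¹ • b := h.2 fun y hy => by
      have := smul_le_smul_of_nonneg_left (hb ⟨y, hy, rfl⟩) (inv_pos.2 hc).le
      simpa [smul_smul, inv_mul_cancel₀ hc.ne'] using this
    have := smul_le_smul_of_nonneg_left this hc.le
    simpa [smul_smul, mul_inv_cancel₀ hc.ne'] using this

/-- Riesz–Kantorovich: if `F` is Dedekind complete, two regular operators have a supremum, whose
value at `x ≥ 0` is the supremum of `S u + T v` over all `u, v ≥ 0` with `u + v = x`. -/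
theorem exists_isLUB_pair [DedekindComplete F] (S T : RegularOperator E F) :
    ∃ R : RegularOperator E F, IsLUB {S, T} R ∧
      ∀ x, 0 ≤ x → IsLUB {z | ∃ u v, 0 ≤ u ∧ 0 ≤ v ∧ u + v = x ∧ z = S u + T v} (R x) := by
  set A : E → Set F := fun x => {z | ∃ u v, 0 ≤ u ∧ 0 ≤ v ∧ u + v = x ∧ z = S u + T v} with hA
  obtain ⟨P, hP, hSP⟩ := exists_nonneg_ge S
  obtain ⟨Q, hQ, hTQ⟩ := exists_nonneg_ge T
  have hex : ∀ x, 0 ≤ x → ∃ a, IsLUB (A x) a := fun x hx => by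
    refine DedekindComplete.exists_isLUB _ ⟨_, x, 0, hx, le_rfl, add_zero x, rfl⟩ ⟨P x + Q x, ?_⟩
    rintro _ ⟨u, v, hu, hv, rfl, rfl⟩
    refine add_le_add ((hSP u hu).trans ?_) ((hTQ v hv).trans ?_)
    · rw [map_add]
      exact le_add_of_nonneg_right (hP v hv)
    · rw [map_add]
      exact le_add_of_nonneg_left (hQ u hu)
  choose! p hp using hex
  have hadd : ∀ x y, 0 ≤ x → 0 ≤ y → p (x + y) = p x + p y := fun x y hx hy => by
    have h1 := (hp x hx).add (hp y hy)
    refine (hp _ (add_nonneg hx hy)).unique ?_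
    convert h1 using 1
    ext z
    rw [Set.mem_add]
    constructor
    · rintro ⟨u, v, hu, hv, huv, rfl⟩
      have hxu : u - u ⊓ x ≤ y := by
        rw [sub_le_iff_le_add, inf_comm, add_inf]
        refine le_inf ?_ (le_add_of_nonneg_left hy)
        rw [add_comm, ← huv]
        exact le_add_of_nonneg_right hv
      refine ⟨_, ⟨u ⊓ x, x - u ⊓ x, le_inf hu hx, sub_nonneg.2 inf_le_right, by abel, rfl⟩,
        _, ⟨u - u ⊓ x, y - (u - u ⊓ x), sub_nonneg.2 inf_le_left, sub_nonneg.2 hxu, by abel, rfl⟩,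
        ?_⟩
      have hv' : v = x + y - u := by rw [← huv]; abel
      rw [hv']
      simp only [map_sub, map_add]
      abel
    · rintro ⟨_, ⟨u, v, hu, hv, rfl, rfl⟩, _, ⟨u', v', hu', hv', rfl, rfl⟩, rfl⟩
      refine ⟨u + u', v + v', add_nonneg hu hu', add_nonneg hv hv', by abel, ?_⟩
      simp only [map_add]
      abel
  have hp0 : p 0 = 0 := by
    have := hadd 0 0 le_rfl le_rfl
    rwa [add_zero, left_eq_add] at this
  have hsmul : ∀ (c : ℝ) (x : E), 0 ≤ c → 0 ≤ x → p (c • x) = c • p x := fun c x hc hx => by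
    rcases hc.eq_or_lt with rfl | hc
    · rw [zero_smul, zero_smul, hp0]
    refine (hp _ (smul_nonneg hc.le hx)).unique ?_
    convert isLUB_smul_pos (hp x hx) hc using 1
    ext z
    constructor
    · rintro ⟨u, v, hu, hv, huv, rfl⟩
      refine ⟨_, ⟨c⁻¹ • u, c⁻¹ • v, smul_nonneg (inv_pos.2 hc).le hu,
        smul_nonneg (inv_pos.2 hc).le hv, ?_, rfl⟩, ?_⟩
      · rw [← smul_add, huv, smul_smul, inv_mul_cancel₀ hc.ne', one_smul]
      · simp only [map_smul]
        rw [smul_add, smul_smul, smul_smul, mul_inv_cancel₀ hc.ne', one_smul, one_smul]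
    · rintro ⟨_, ⟨u, v, hu, hv, rfl, rfl⟩, rfl⟩
      refine ⟨c • u, c • v, smul_nonneg hc.le hu, smul_nonneg hc.le hv, (smul_add _ _ _).symm, ?_⟩
      simp only [map_smul, smul_add]
  obtain ⟨L, hL⟩ := exists_linearMap_extension p hadd hsmul
  have hSL : ∀ x, 0 ≤ x → S x ≤ L x := fun x hx => by
    rw [hL x hx]
    exact (hp x hx).1 ⟨x, 0, hx, le_rfl, add_zero x, by rw [map_zero, add_zero]⟩
  have hTL : ∀ x, 0 ≤ x → T x ≤ L x := fun x hx => by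
    rw [hL x hx]
    exact (hp x hx).1 ⟨0, x, le_rfl, hx, zero_add x, by rw [map_zero, zero_add]⟩
  obtain ⟨R, rfl⟩ := exists_toLinearMap_eq S L hSL
  refine ⟨R, ⟨?_, fun R' hR' x hx => ?_⟩, fun x hx => by rw [hL x hx]; exact hp x hx⟩
  · rintro _ (rfl | rfl)
    · exact hSL
    · exact hTL
  · rw [hL x hx]
    refine (hp x hx).2 ?_
    rintro _ ⟨u, v, hu, hv, rfl, rfl⟩
    rw [map_add]
    exact add_le_add (hR' (Set.mem_insert _ _) u hu)
      (hR' (Set.mem_insert_of_mem _ rfl) v hv)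

/-- The regular operators into a Dedekind complete Riesz space form a Riesz space; the supremum is
the least upper bound for the operator order. -/
noncomputable instance [DedekindComplete F] : Lattice (RegularOperator E F) where
  sup S T := (exists_isLUB_pair S T).choose
  le_sup_left S T := (exists_isLUB_pair S T).choose_spec.1.1 (Set.mem_insert _ _)
  le_sup_right S T := (exists_isLUB_pair S T).choose_spec.1.1 (Set.mem_insert_of_mem _ rfl)
  sup_le S T R hS hT := (exists_isLUB_pair S T).choose_spec.1.2
    (by rintro _ (rfl | rfl) <;> assumption)
  inf S T := -(exists_isLUB_pair (-S) (-T)).choose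
  inf_le_left S T := neg_le.1
    ((exists_isLUB_pair (-S) (-T)).choose_spec.1.1 (Set.mem_insert _ _))
  inf_le_right S T := neg_le.1
    ((exists_isLUB_pair (-S) (-T)).choose_spec.1.1 (Set.mem_insert_of_mem _ rfl))
  le_inf R S T hS hT := le_neg.1 ((exists_isLUB_pair (-S) (-T)).choose_spec.1.2
    (by rintro _ (rfl | rfl) <;> rwa [neg_le_neg_iff]))

/-- The regular operators into a Dedekind complete Riesz space form a Dedekind complete space. -/
instance [DedekindComplete F] : DedekindComplete (RegularOperator E F) where
  exists_isLUB := by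
    intro s hs hb
    obtain ⟨T, hT⟩ := hs
    obtain ⟨U, hU⟩ := hb
    set B := upperBounds s with hB
    set A : E → Set F := fun x => {z | ∃ R ∈ B, z = R x} with hA
    have hex : ∀ x, 0 ≤ x → ∃ a, IsGLB (A x) a := fun x hx => by
      refine DedekindComplete.exists_isGLB _ ⟨_, U, hU, rfl⟩ ⟨T x, ?_⟩
      rintro _ ⟨R, hR, rfl⟩
      exact hR hT x hx
    choose! p hp using hex
    have hadd : ∀ x y, 0 ≤ x → 0 ≤ y → p (x + y) = p x + p y := fun x y hx hy => by
      have h1 := (hp x hx).add (hp y hy)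
      have h2 := hp _ (add_nonneg hx hy)
      refine le_antisymm (h1.2 ?_) (h2.2 ?_)
      · rintro _ ⟨_, ⟨R, hR, rfl⟩, _, ⟨R', hR', rfl⟩, rfl⟩
        have h3 : R ⊓ R' ∈ B := fun V hV => le_inf (hR hV) (hR' hV)
        refine (h2.1 ⟨_, h3, rfl⟩).trans ?_
        rw [map_add]
        exact add_le_add ((inf_le_left : R ⊓ R' ≤ R) x hx) ((inf_le_right : R ⊓ R' ≤ R') y hy)
      · rintro _ ⟨R, hR, rfl⟩
        rw [map_add]
        exact h1.1 (Set.add_mem_add ⟨R, hR, rfl⟩ ⟨R, hR, rfl⟩)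
    have hp0 : p 0 = 0 := by
      have := hadd 0 0 le_rfl le_rfl
      rwa [add_zero, left_eq_add] at this
    have hle : ∀ (c : ℝ) (x : E), 0 < c → 0 ≤ x → c • p x ≤ p (c • x) := fun c x hc hx => by
      refine (hp _ (smul_nonneg hc.le hx)).2 ?_
      rintro _ ⟨R, hR, rfl⟩
      rw [map_smul]
      exact smul_le_smul_of_nonneg_left ((hp x hx).1 ⟨R, hR, rfl⟩) hc.le
    have hsmul : ∀ (c : ℝ) (x : E), 0 ≤ c → 0 ≤ x → p (c • x) = c • p x := fun c x hc hx => by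
      rcases hc.eq_or_lt with rfl | hc
      · rw [zero_smul, zero_smul, hp0]
      refine le_antisymm ?_ (hle c x hc hx)
      have h1 := smul_le_smul_of_nonneg_left
        (hle c⁻¹ (c • x) (inv_pos.2 hc) (smul_nonneg hc.le hx)) hc.le
      rwa [smul_smul, smul_smul, mul_inv_cancel₀ hc.ne', inv_mul_cancel₀ hc.ne', one_smul,
        one_smul] at h1
    obtain ⟨L, hL⟩ := exists_linearMap_extension p hadd hsmul
    have hsL : ∀ V ∈ s, ∀ x, 0 ≤ x → V x ≤ L x := fun V hV x hx => by
      rw [hL x hx]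
      refine (hp x hx).2 ?_
      rintro _ ⟨R, hR, rfl⟩
      exact hR hV x hx
    obtain ⟨R, rfl⟩ := exists_toLinearMap_eq T L (hsL T hT)
    refine ⟨R, hsL, fun R' hR' x hx => ?_⟩
    rw [hL x hx]
    exact (hp x hx).1 ⟨R', hR', rfl⟩

/-- The values whose supremum is the operator norm of the modulus of `T`. -/
def modulusNorms [Norm E] [Norm F] [DedekindComplete F] (T : RegularOperator E F) : Set ℝ :=
  {r | ∃ x : E, ‖x‖ ≤ 1 ∧ r = ‖|T| x‖}

/-- The regular norm `‖T‖_r = ‖|T|‖`: the operator norm of the modulus of `T`. -/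
noncomputable instance [Norm E] [Norm F] [DedekindComplete F] : Norm (RegularOperator E F) where
  norm T := sSup T.modulusNorms

/-- The composition of two regular operators. -/
def comp (S : RegularOperator F G) (T : RegularOperator E F) : RegularOperator E G :=
  ⟨S.toLinearMap ∘ₗ T.toLinearMap, by
    obtain ⟨P, Q, hP, hQ, hS⟩ := S.2
    obtain ⟨P', Q', hP', hQ', hT⟩ := T.2
    refine ⟨P ∘ₗ P' + Q ∘ₗ Q', P ∘ₗ Q' + Q ∘ₗ P',
      fun x hx => add_nonneg (hP _ (hP' x hx)) (hQ _ (hQ' x hx)),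
      fun x hx => add_nonneg (hP _ (hQ' x hx)) (hQ _ (hP' x hx)), ?_⟩
    change S.1 ∘ₗ T.1 = _
    rw [hS, hT, LinearMap.sub_comp, LinearMap.comp_sub, LinearMap.comp_sub]
    abel⟩

end RegularOperator

section TwoSidedMultiplication

variable {W X Y Z : Type*}
  [AddCommGroup W] [Lattice W] [IsOrderedAddMonoid W] [Module ℝ W] [IsOrderedModule ℝ W]
  [AddCommGroup X] [Lattice X] [IsOrderedAddMonoid X] [Module ℝ X] [IsOrderedModule ℝ X]
  [AddCommGroup Y] [Lattice Y] [IsOrderedAddMonoid Y] [Module ℝ Y] [IsOrderedModule ℝ Y]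
  [AddCommGroup Z] [Lattice Z] [IsOrderedAddMonoid Z] [Module ℝ Z] [IsOrderedModule ℝ Z]

/-- The linear map `T ↦ A T B` from `L^r(X, Y)` to `L^r(W, Z)`. -/
def twoSidedMulLinear (A : RegularOperator Y Z) (B : RegularOperator W X) :
    RegularOperator X Y →ₗ[ℝ] RegularOperator W Z where
  toFun T := A.comp (T.comp B)
  map_add' S T := RegularOperator.ext_nonneg fun w _ =>
    map_add A.toLinearMap (S (B w)) (T (B w))
  map_smul' c T := RegularOperator.ext_nonneg fun w _ =>
    map_smul A.toLinearMap c (T (B w))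

/-- The two-sided multiplication operator `M_{A,B} : T ↦ A T B`, as a regular operator from
`L^r(X, Y)` to `L^r(W, Z)`. -/
def twoSidedMul [DedekindComplete Y] [DedekindComplete Z] (A : RegularOperator Y Z)
    (B : RegularOperator W X) : RegularOperator (RegularOperator X Y) (RegularOperator W Z) :=
  ⟨twoSidedMulLinear A B, by
    obtain ⟨P, Q, hP, hQ, hA⟩ := A.2
    obtain ⟨P', Q', hP', hQ', hB⟩ := B.2
    set p : RegularOperator Y Z := ⟨P, P, 0, hP, fun _ _ => le_rfl, (sub_zero P).symm⟩
    set q : RegularOperator Y Z := ⟨Q, Q, 0, hQ, fun _ _ => le_rfl, (sub_zero Q).symm⟩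
    set p' : RegularOperator W X := ⟨P', P', 0, hP', fun _ _ => le_rfl, (sub_zero P').symm⟩
    set q' : RegularOperator W X := ⟨Q', Q', 0, hQ', fun _ _ => le_rfl, (sub_zero Q').symm⟩
    refine ⟨twoSidedMulLinear p p' + twoSidedMulLinear q q',
      twoSidedMulLinear p q' + twoSidedMulLinear q p',
      fun T hT => add_nonneg (fun w hw => hP _ (hT _ (hP' w hw)))
        (fun w hw => hQ _ (hT _ (hQ' w hw))),
      fun T hT => add_nonneg (fun w hw => hP _ (hT _ (hQ' w hw)))
        (fun w hw => hQ _ (hT _ (hP' w hw))), ?_⟩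
    refine LinearMap.ext fun T => RegularOperator.ext_nonneg fun w _ => ?_
    change A.1 (T.toLinearMap (B.1 w)) =
      (P (T.toLinearMap (P' w)) + Q (T.toLinearMap (Q' w))) -
        (P (T.toLinearMap (Q' w)) + Q (T.toLinearMap (P' w)))
    rw [hA, hB]
    simp only [LinearMap.sub_apply, map_sub]
    abel⟩

end TwoSidedMultiplication
end RegularOperators

/-! The upper bound follows from `|M_{A,B}| ≤ M_{|A|,|B|}` (`abs_twoSidedMul_le`) and the norm
bounds for `|A|`, `|T|` and `|B|`.

For the lower bound, rank one operators `ψ ⊗ y : x ↦ ψ(x) y` suffice, with `y, w ≥ 0` in the unit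
balls and `ψ` a positive functional norming `|B| w`. At such an operator and at `w`, `M_{|A|,|B|}`
has the value `ψ(|B| w) |A| y`, of norm `‖|A| y‖ ‖|B| w‖`. The heart of the matter
(`smul_abs_apply_le_of_abs_twoSidedMul_le`) is that every `N ≥ |M_{A,B}|` dominates this value.

The reason is that `N(φ ⊗ y) w` is additive in `φ`, `y` and `w` separately. Splitting `y` as in the
Riesz–Kantorovich formula produces `|A| y`; splitting `w = u + v` replaces `B w` by `B u - B v`;
splitting `φ` produces finite suprema of such elements. These suprema increase to `|B| w`, and order
continuity of the norm of `X` makes this norm convergence, which `ψ` respects. For `Y`, order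
continuity enters only through Dedekind completeness. -/

/-! ### Positive functionals and boundedness of positive operators -/

section Functionals

/-- Hahn–Banach: a nonnegative sublinear functional dominates a linear functional that agrees with
it at a given point. -/
theorem exists_linearMap_le_sublinear {E : Type*} [AddCommGroup E] [Module ℝ E] (N : E → ℝ)
    (hN : ∀ x, 0 ≤ N x) (hsmul : ∀ c : ℝ, 0 < c → ∀ x, N (c • x) = c * N x)
    (hadd : ∀ x y, N (x + y) ≤ N x + N y) (v : E) :
    ∃ φ : E →ₗ[ℝ] ℝ, φ v = N v ∧ ∀ x, φ x ≤ N x := by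
  have h0 : N 0 = 0 := by
    have := hsmul 2 two_pos 0
    rw [smul_zero] at this
    linarith
  have hv : ∀ c : ℝ, c • v = 0 → c • N v = 0 := fun c hc => by
    rcases smul_eq_zero.1 hc with rfl | rfl
    · exact zero_smul _ _
    · rw [h0, smul_zero]
  obtain ⟨φ, h1, h2⟩ := exists_extension_of_le_sublinear
    (LinearPMap.mkSpanSingleton' (σ := RingHom.id ℝ) v (N v) hv) N hsmul hadd (by
      rintro ⟨x, hx⟩
      obtain ⟨c, rfl⟩ := Submodule.mem_span_singleton.1 hx
      rw [LinearPMap.mkSpanSingleton'_apply, RingHom.id_apply, smul_eq_mul]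
      -- On the ray `c ≤ 0` the prescribed value `c * N v` is nonpositive, so `N ≥ 0` suffices.
      rcases le_or_gt c 0 with hc | hc
      · exact (mul_nonpos_of_nonpos_of_nonneg hc (hN v)).trans (hN _)
      · exact (hsmul c hc v).ge)
  refine ⟨φ, ?_, h2⟩
  have hmem : v ∈ (LinearPMap.mkSpanSingleton' (σ := RingHom.id ℝ) v (N v) hv).domain :=
    Submodule.mem_span_singleton_self v
  exact (h1 ⟨v, hmem⟩).trans (LinearPMap.mkSpanSingleton'_apply_self _ _ _ _)

variable {E : Type*} [AddCommGroup E] [Lattice E] [IsOrderedAddMonoid E] [Module ℝ E]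
  [IsOrderedModule ℝ E]

theorem posPart_smul_of_pos {c : ℝ} (hc : 0 < c) (x : E) : (c • x)⁺ = c • x⁺ := by
  refine le_antisymm (sup_le (smul_le_smul_of_nonneg_left (le_posPart x) hc.le)
    (smul_nonneg hc.le (posPart_nonneg x))) ?_
  have h : x⁺ ≤ c⁻¹ • (c • x)⁺ := by
    refine sup_le ?_ (smul_nonneg (inv_pos.2 hc).le (posPart_nonneg _))
    have := smul_le_smul_of_nonneg_left (le_posPart (c • x)) (inv_pos.2 hc).le
    rwa [smul_smul, inv_mul_cancel₀ hc.ne', one_smul] at this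
  have := smul_le_smul_of_nonneg_left h hc.le
  rwa [smul_smul, mul_inv_cancel₀ hc.ne', one_smul] at this

theorem posPart_add_le_add (x y : E) : (x + y)⁺ ≤ x⁺ + y⁺ :=
  sup_le (add_le_add (le_posPart x) (le_posPart y))
    (add_nonneg (posPart_nonneg x) (posPart_nonneg y))

theorem IsPositiveOperator.mono {F : Type*} [AddCommGroup F] [Lattice F] [IsOrderedAddMonoid F]
    [Module ℝ F] {T : E →ₗ[ℝ] F} (hT : IsPositiveOperator T) {x y : E} (h : x ≤ y) :
    T x ≤ T y := by
  have := hT _ (sub_nonneg.2 h)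
  rwa [map_sub, sub_nonneg] at this

theorem IsPositiveOperator.abs_apply_le {F : Type*} [AddCommGroup F] [Lattice F]
    [IsOrderedAddMonoid F] [Module ℝ F] {T : E →ₗ[ℝ] F} (hT : IsPositiveOperator T) (x : E) :
    |T x| ≤ T |x| :=
  abs_le'.2 ⟨hT.mono (le_abs_self x), by rw [← map_neg]; exact hT.mono (neg_le_abs x)⟩

/-- The value `ψ(v⁺)` is attained at `v` by a functional between `0` and `ψ`. -/
theorem exists_functional_le_apply_posPart {ψ : E →ₗ[ℝ] ℝ} (hψ : IsPositiveOperator ψ) (v : E) :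
    ∃ φ : E →ₗ[ℝ] ℝ, IsPositiveOperator φ ∧ IsPositiveOperator (ψ - φ) ∧ φ v = ψ v⁺ := by
  -- Domination by `x ↦ ψ(x⁺)` encodes `0 ≤ φ ≤ ψ`: for `x ≥ 0` it reads `φ(x) ≤ ψ(x)` at `x` and
  -- `φ(-x) ≤ 0` at `-x`.
  obtain ⟨φ, h1, h2⟩ := exists_linearMap_le_sublinear (fun x => ψ x⁺)
    (fun x => hψ _ (posPart_nonneg x))
    (fun c hc x => by rw [posPart_smul_of_pos hc, map_smul, smul_eq_mul])
    (fun x y => (hψ.mono (posPart_add_le_add x y)).trans_eq (map_add _ _ _)) v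
  refine ⟨φ, fun x hx => ?_, fun x hx => ?_, h1⟩
  · have := h2 (-x)
    rw [posPart_eq_zero.2 (neg_nonpos.2 hx), map_zero, map_neg] at this
    linarith
  · have := h2 x
    rw [posPart_of_nonneg hx] at this
    exact sub_nonneg.2 this

/-- In a normed Riesz space every positive element is normed by a positive functional. -/
theorem exists_functional_norming {E : Type*} [NormedAddCommGroup E] [Lattice E] [HasSolidNorm E]
    [IsOrderedAddMonoid E] [NormedSpace ℝ E] [IsOrderedModule ℝ E] {v : E} (hv : 0 ≤ v) :
    ∃ φ : E →ₗ[ℝ] ℝ, IsPositiveOperator φ ∧ (∀ x, |φ x| ≤ ‖x‖) ∧ φ v = ‖v‖ := by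
  -- Using `‖x⁺‖` instead of `‖x‖` forces `φ` to be positive, since the bound vanishes on negative
  -- elements.
  obtain ⟨φ, h1, h2⟩ := exists_linearMap_le_sublinear (fun x : E => ‖x⁺‖)
    (fun x => norm_nonneg _)
    (fun c hc x => by rw [posPart_smul_of_pos hc, norm_smul, Real.norm_of_nonneg hc.le])
    (fun x y => (norm_le_norm_of_abs_le_abs (by
      rw [abs_of_nonneg (posPart_nonneg _),
        abs_of_nonneg (add_nonneg (posPart_nonneg x) (posPart_nonneg y))]
      exact posPart_add_le_add x y)).trans (norm_add_le _ _)) v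
  rw [posPart_of_nonneg hv] at h1
  have hle : ∀ x, φ x ≤ ‖x‖ := fun x => (h2 x).trans (norm_le_norm_of_abs_le_abs (by
    rw [abs_of_nonneg (posPart_nonneg _)]
    exact sup_le (le_abs_self x) (abs_nonneg x)))
  refine ⟨φ, fun x hx => ?_, fun x => abs_le'.2 ⟨hle x, ?_⟩, h1⟩
  · have := h2 (-x)
    rw [posPart_eq_zero.2 (neg_nonpos.2 hx), norm_zero, map_neg] at this
    linarith
  · rw [← map_neg, ← norm_neg x]
    exact hle (-x)

/-- Positive operators on Banach lattices are bounded on the positive part of the unit ball. -/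
theorem IsPositiveOperator.exists_norm_apply_le {E F : Type*}
    [NormedAddCommGroup E] [Lattice E] [HasSolidNorm E] [IsOrderedAddMonoid E] [NormedSpace ℝ E]
    [IsOrderedModule ℝ E] [CompleteSpace E]
    [NormedAddCommGroup F] [Lattice F] [HasSolidNorm F] [IsOrderedAddMonoid F] [NormedSpace ℝ F]
    {T : E →ₗ[ℝ] F} (hT : IsPositiveOperator T) :
    ∃ C : ℝ, ∀ x, 0 ≤ x → ‖x‖ ≤ 1 → ‖T x‖ ≤ C := by
  by_contra! h
  -- The weights `2⁻ⁿ` make the series of the `x n` converge, while the images of its terms keep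
  -- norm at least `2ⁿ`; by positivity the image of the sum dominates each of them.
  choose x hx0 hx1 hx using fun n : ℕ => h (4 ^ n)
  have hterm : ∀ n, 0 ≤ ((1 / 2 : ℝ) ^ n) • x n := fun n => smul_nonneg (by positivity) (hx0 n)
  have hs : Summable fun n => ((1 / 2 : ℝ) ^ n) • x n := by
    refine Summable.of_norm_bounded summable_geometric_two fun n => ?_
    rw [norm_smul, Real.norm_of_nonneg (by positivity)]
    exact mul_le_of_le_one_right (by positivity) (hx1 n)
  have hle : ∀ n : ℕ, (2 : ℝ) ^ n ≤ ‖T (∑' n, ((1 / 2 : ℝ) ^ n) • x n)‖ := fun n => by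
    have h1 := hT.mono (hs.le_tsum n fun m _ => hterm m)
    have h2 : ‖T (((1 / 2 : ℝ) ^ n) • x n)‖ ≤ ‖T (∑' n, ((1 / 2 : ℝ) ^ n) • x n)‖ :=
      norm_le_norm_of_abs_le_abs (by
        rw [abs_of_nonneg (hT _ (hterm n))]
        exact h1.trans (le_abs_self _))
    refine le_trans ?_ h2
    rw [map_smul, norm_smul, Real.norm_of_nonneg (by positivity)]
    calc (2 : ℝ) ^ n = (1 / 2) ^ n * 4 ^ n := by rw [← mul_pow]; norm_num
      _ ≤ _ := mul_le_mul_of_nonneg_left (hx n).le (by positivity)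
  obtain ⟨n, hn⟩ := pow_unbounded_of_one_lt (‖T (∑' n, ((1 / 2 : ℝ) ^ n) • x n)‖) one_lt_two
  exact (hle n).not_gt hn

end Functionals

/-! ### The modulus of a regular operator -/

namespace RegularOperator

section Modulus

variable {E F : Type*}
  [AddCommGroup E] [Lattice E] [IsOrderedAddMonoid E] [Module ℝ E] [IsOrderedModule ℝ E]
  [AddCommGroup F] [Lattice F] [IsOrderedAddMonoid F] [Module ℝ F] [IsOrderedModule ℝ F]

theorem isPositiveOperator {T : RegularOperator E F} (hT : 0 ≤ T) :
    IsPositiveOperator T.toLinearMap := fun x hx => hT x hx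

variable [DedekindComplete F]

theorem isPositiveOperator_abs (T : RegularOperator E F) :
    IsPositiveOperator (|T|).toLinearMap := isPositiveOperator (abs_nonneg T)

theorem abs_apply_le (T : RegularOperator E F) (x : E) : |T x| ≤ |T| |x| := by
  have hpos : ∀ y, 0 ≤ y → |T y| ≤ |T| y := fun y hy =>
    abs_le'.2 ⟨le_abs_self T y hy, neg_le_abs T y hy⟩
  calc |T x| = |T x⁺ - T x⁻| := by rw [← map_sub, posPart_sub_negPart]
    _ ≤ |T x⁺| + |T x⁻| := by
      rw [sub_eq_add_neg, ← abs_neg (T x⁻)]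
      exact abs_add_le _ _
    _ ≤ |T| x⁺ + |T| x⁻ := add_le_add (hpos _ (posPart_nonneg x)) (hpos _ (negPart_nonneg x))
    _ = |T| |x| := by rw [← map_add, posPart_add_negPart]

/-- The Riesz–Kantorovich formula for the modulus. -/
theorem isLUB_abs_apply (T : RegularOperator E F) {x : E} (hx : 0 ≤ x) :
    IsLUB {z | ∃ u v, 0 ≤ u ∧ 0 ≤ v ∧ u + v = x ∧ z = T u - T v} (|T| x) := by
  obtain ⟨R, hR, h⟩ := exists_isLUB_pair T (-T)
  have hR' : |T| = R := isLUB_pair.unique hR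
  rw [hR']
  simpa [toLinearMap_neg, sub_eq_add_neg] using h x hx

/-- A positive scalar passes through the Riesz–Kantorovich supremum. For `c = 0` the decomposition
`x = x + 0` alone gives `0 ≤ b`. -/
theorem smul_abs_apply_le (T : RegularOperator E F) {x : E} (hx : 0 ≤ x) {c : ℝ} (hc : 0 ≤ c)
    {b : F} (hb : ∀ u v, 0 ≤ u → 0 ≤ v → u + v = x → c • (T u - T v) ≤ b) :
    c • |T| x ≤ b := by
  rcases hc.eq_or_lt with rfl | hc
  · have := hb x 0 hx le_rfl (add_zero x)
    rwa [zero_smul] at this ⊢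
  · refine (isLUB_smul_pos (T.isLUB_abs_apply hx) hc).2 ?_
    rintro _ ⟨_, ⟨u, v, hu, hv, huv, rfl⟩, rfl⟩
    exact hb u v hu hv huv

end Modulus

/-! ### The regular norm -/

section RegularNorm

variable {E F : Type*}
  [NormedAddCommGroup E] [Lattice E] [HasSolidNorm E] [IsOrderedAddMonoid E] [NormedSpace ℝ E]
  [IsOrderedModule ℝ E]
  [NormedAddCommGroup F] [Lattice F] [HasSolidNorm F] [IsOrderedAddMonoid F] [NormedSpace ℝ F]
  [IsOrderedModule ℝ F] [DedekindComplete F]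

theorem norm_abs_apply_le_norm_abs_apply_abs (T : RegularOperator E F) (x : E) :
    ‖|T| x‖ ≤ ‖|T| |x|‖ :=
  norm_le_norm_of_abs_le_abs (((isPositiveOperator_abs T).abs_apply_le x).trans (le_abs_self _))

/-- Positive operators on a Banach lattice are automatically bounded. Without finiteness the `sSup`
in `‖T‖` would take the default value `0`. -/
theorem bddAbove_modulusNorms [CompleteSpace E] (T : RegularOperator E F) :
    BddAbove T.modulusNorms := by
  obtain ⟨C, hC⟩ := (isPositiveOperator_abs T).exists_norm_apply_le
  refine ⟨C, ?_⟩
  rintro _ ⟨x, hx, rfl⟩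
  exact (T.norm_abs_apply_le_norm_abs_apply_abs x).trans
    (hC _ (abs_nonneg x) (by rwa [norm_abs_eq_norm]))

theorem regularNorm_nonneg (T : RegularOperator E F) : 0 ≤ ‖T‖ :=
  Real.sSup_nonneg (by rintro _ ⟨x, -, rfl⟩; exact norm_nonneg _)

theorem norm_abs_apply_le [CompleteSpace E] (T : RegularOperator E F) (x : E) :
    ‖|T| x‖ ≤ ‖T‖ * ‖x‖ := by
  rcases eq_or_ne x 0 with rfl | hx
  · simp
  have hx' : 0 < ‖x‖ := norm_pos_iff.2 hx
  have h : ‖|T| (‖x‖⁻¹ • x)‖ ≤ ‖T‖ := le_csSup T.bddAbove_modulusNorms ⟨_, by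
    rw [norm_smul, norm_inv, norm_norm, inv_mul_cancel₀ hx'.ne'], rfl⟩
  rw [map_smul, norm_smul, norm_inv, norm_norm, inv_mul_le_iff₀ hx', mul_comm] at h
  exact h

end RegularNorm

/-! ### Rank one operators -/

section RankOne

variable {E F : Type*}
  [AddCommGroup E] [Lattice E] [IsOrderedAddMonoid E] [Module ℝ E] [IsOrderedModule ℝ E]
  [AddCommGroup F] [Lattice F] [IsOrderedAddMonoid F] [Module ℝ F] [IsOrderedModule ℝ F]

/-- The rank one operator `x ↦ φ(x) y` of a positive functional `φ`. -/
def rankOne (φ : E →ₗ[ℝ] ℝ) (hφ : IsPositiveOperator φ) (y : F) : RegularOperator E F :=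
  ⟨φ.smulRight y, φ.smulRight y⁺, φ.smulRight y⁻,
    fun x hx => smul_nonneg (hφ x hx) (posPart_nonneg y),
    fun x hx => smul_nonneg (hφ x hx) (negPart_nonneg y), LinearMap.ext fun x => by
      simp only [LinearMap.sub_apply, LinearMap.smulRight_apply]
      rw [← smul_sub, posPart_sub_negPart]⟩

theorem rankOne_apply (φ : E →ₗ[ℝ] ℝ) (hφ : IsPositiveOperator φ) (y : F) (x : E) :
    rankOne φ hφ y x = φ x • y := rfl

theorem rankOne_nonneg {φ : E →ₗ[ℝ] ℝ} (hφ : IsPositiveOperator φ) {y : F} (hy : 0 ≤ y) :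
    0 ≤ rankOne φ hφ y := fun x hx => smul_nonneg (hφ x hx) hy

theorem rankOne_add (φ : E →ₗ[ℝ] ℝ) (hφ : IsPositiveOperator φ) (u v : F) :
    rankOne φ hφ (u + v) = rankOne φ hφ u + rankOne φ hφ v :=
  ext_nonneg fun x _ => smul_add (φ x) u v

theorem rankOne_eq_add_rankOne_sub {φ ψ : E →ₗ[ℝ] ℝ} (hφ : IsPositiveOperator φ)
    (hψ : IsPositiveOperator ψ) (h : IsPositiveOperator (ψ - φ)) (y : F) :
    rankOne ψ hψ y = rankOne φ hφ y + rankOne (ψ - φ) h y :=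
  ext_nonneg fun x _ => by
    change ψ x • y = φ x • y + (ψ x - φ x) • y
    rw [← add_smul, add_sub_cancel]

end RankOne

end RegularOperator

/-! ### Bounds for the modulus of `M_{A,B}` -/

section TwoSidedMultiplicationModulus

open RegularOperator

variable {W X Y Z : Type*}
  [AddCommGroup W] [Lattice W] [IsOrderedAddMonoid W] [Module ℝ W] [IsOrderedModule ℝ W]
  [AddCommGroup Y] [Lattice Y] [IsOrderedAddMonoid Y] [Module ℝ Y] [IsOrderedModule ℝ Y]
  [DedekindComplete Y]

section Algebraic

variable
  [AddCommGroup X] [Lattice X] [IsOrderedAddMonoid X] [Module ℝ X] [IsOrderedModule ℝ X]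
  [AddCommGroup Z] [Lattice Z] [IsOrderedAddMonoid Z] [Module ℝ Z] [IsOrderedModule ℝ Z]
  [DedekindComplete Z]

theorem twoSidedMul_apply (A : RegularOperator Y Z) (B : RegularOperator W X)
    (T : RegularOperator X Y) (w : W) : twoSidedMul A B T w = A (T (B w)) := rfl

/-- For `T, w ≥ 0`, `|A T B w| ≤ |A| |T B w| ≤ |A| T |B w| ≤ |A| T |B| w`, which bounds both
`M_{A,B}` and its negative. -/
theorem abs_twoSidedMul_le [DedekindComplete X] (A : RegularOperator Y Z)
    (B : RegularOperator W X) : |twoSidedMul (X := X) (Y := Y) A B| ≤ twoSidedMul |A| |B| := by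
  have h : ∀ T : RegularOperator X Y, 0 ≤ T → ∀ w, 0 ≤ w →
      |A (T (B w))| ≤ |A| (T (|B| w)) := fun T hT w hw => by
    have h1 := isPositiveOperator_abs A
    refine (A.abs_apply_le _).trans (h1.mono ?_)
    refine ((isPositiveOperator hT).abs_apply_le _).trans ((isPositiveOperator hT).mono ?_)
    simpa only [abs_of_nonneg hw] using B.abs_apply_le w
  exact abs_le'.2 ⟨fun T hT w hw => (le_abs_self _).trans (h T hT w hw),
    fun T hT w hw => (neg_le_abs _).trans (h T hT w hw)⟩

variable {A : RegularOperator Y Z} {B : RegularOperator W X}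
  {N : RegularOperator (RegularOperator X Y) (RegularOperator W Z)}

/-- Since `M_{A,B}(φ ⊗ u) w = φ(B w) A u`, both signs of this lie below `N(φ ⊗ u) w` for `u ≥ 0`.
Adding the bounds with opposite signs over `y = u + v` and taking the supremum produces `|A| y`. -/
theorem abs_smul_abs_apply_le_of_abs_twoSidedMul_le (hN : |twoSidedMul A B| ≤ N)
    {φ : X →ₗ[ℝ] ℝ} (hφ : IsPositiveOperator φ) {y : Y} (hy : 0 ≤ y) {w : W} (hw : 0 ≤ w) :
    |φ (B w)| • |A| y ≤ N (rankOne φ hφ y) w := by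
  have h1 : ∀ u, 0 ≤ u → φ (B w) • A u ≤ N (rankOne φ hφ u) w := fun u hu => by
    have := (le_abs_self _).trans hN _ (rankOne_nonneg hφ hu) w hw
    rwa [twoSidedMul_apply, rankOne_apply, map_smul] at this
  have h2 : ∀ u, 0 ≤ u → -(φ (B w) • A u) ≤ N (rankOne φ hφ u) w := fun u hu => by
    have h : -(A (rankOne φ hφ u (B w))) ≤ _ :=
      (neg_le_abs _).trans hN _ (rankOne_nonneg hφ hu) w hw
    rwa [rankOne_apply, map_smul] at h
  refine smul_abs_apply_le A hy (abs_nonneg _) fun u v hu hv huv => ?_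
  rw [← huv, rankOne_add, map_add, toLinearMap_add, LinearMap.add_apply]
  rcases le_total 0 (φ (B w)) with hc | hc
  · rw [abs_of_nonneg hc, smul_sub, sub_eq_add_neg]
    exact add_le_add (h1 u hu) (h2 v hv)
  · rw [abs_of_nonpos hc, neg_smul, smul_sub, neg_sub, sub_eq_neg_add]
    exact add_le_add (h2 u hu) (h1 v hv)

end Algebraic

/-- A majorant of the modulus of `M_{A,B}` dominates `M_{|A|,|B|}` at rank one operators. -/
theorem smul_abs_apply_le_of_abs_twoSidedMul_le
    [NormedAddCommGroup X] [Lattice X] [HasSolidNorm X] [IsOrderedAddMonoid X]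
    [NormedSpace ℝ X] [IsOrderedModule ℝ X] [CompleteSpace X] [OrderContinuousNorm X]
    [NormedAddCommGroup Z] [Lattice Z] [HasSolidNorm Z] [IsOrderedAddMonoid Z]
    [NormedSpace ℝ Z] [IsOrderedModule ℝ Z] [DedekindComplete Z]
    {A : RegularOperator Y Z} {B : RegularOperator W X}
    {N : RegularOperator (RegularOperator X Y) (RegularOperator W Z)}
    (hN : |twoSidedMul A B| ≤ N) {ψ : X →ₗ[ℝ] ℝ} (hψ : IsPositiveOperator ψ)
    (hψn : ∀ x, |ψ x| ≤ ‖x‖) {y : Y} (hy : 0 ≤ y) {w : W} (hw : 0 ≤ w) :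
    ψ (|B| w) • |A| y ≤ N (rankOne ψ hψ y) w := by
  have hAy : 0 ≤ |A| y := isPositiveOperator_abs A y hy
  -- All positive `φ` are admitted, not just `ψ`: closure under suprema splits `φ` into two smaller
  -- functionals.
  set Γ : Set X := {z | ∀ (φ : X →ₗ[ℝ] ℝ) (hφ : IsPositiveOperator φ),
    φ z • |A| y ≤ N (rankOne φ hφ y) w} with hΓ
  have hsub : ∀ u v, 0 ≤ u → 0 ≤ v → u + v = w → B u - B v ∈ Γ := by
    rintro u v hu hv rfl φ hφ
    rw [map_add, map_sub, sub_eq_add_neg, add_smul]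
    exact add_le_add
      ((smul_le_smul_of_nonneg_right (le_abs_self _) hAy).trans
        (abs_smul_abs_apply_le_of_abs_twoSidedMul_le hN hφ hy hu))
      ((smul_le_smul_of_nonneg_right (neg_le_abs _) hAy).trans
        (abs_smul_abs_apply_le_of_abs_twoSidedMul_le hN hφ hy hv))
  -- With `0 ≤ χ ≤ φ` and `χ(z - z') = φ((z - z')⁺)`, one has `φ(z ⊔ z') = χ(z) + (φ - χ)(z')`.
  have hsup : ∀ z ∈ Γ, ∀ z' ∈ Γ, z ⊔ z' ∈ Γ := fun z hz z' hz' φ hφ => by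
    obtain ⟨χ, hχ, hφχ, h⟩ := exists_functional_le_apply_posPart hφ (z - z')
    have hval : φ (z ⊔ z') = χ z + (φ - χ) z' := by
      rw [sup_eq_add_posPart_sub, map_add, ← h, map_sub, LinearMap.sub_apply]
      ring
    rw [hval, rankOne_eq_add_rankOne_sub hχ hφ hφχ, map_add, add_smul, toLinearMap_add,
      LinearMap.add_apply]
    exact add_le_add (hz χ hχ) (hz' _ hφχ)
  have hlub := B.isLUB_abs_apply hw
  -- It remains to approximate `ψ(|B| w)` by values `ψ(z)` with `z ∈ Γ`.
  have hclosed : IsClosed {t : ℝ | t • |A| y ≤ N (rankOne ψ hψ y) w} :=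
    isClosed_le (by fun_prop) continuous_const
  refine hclosed.closure_subset (Metric.mem_closure_iff.2 fun ε hε => ?_)
  -- The differences `|B| w - z` are directed downward by `hsup`. Their infimum is `0` because the
  -- elements `B u - B v` of `Γ` already have supremum `|B| w`.
  obtain ⟨_, ⟨z, hz, -, rfl⟩, hzε⟩ := OrderContinuousNorm.exists_norm_lt
    {d | ∃ z ∈ Γ, z ≤ |B| w ∧ d = |B| w - z}
    ⟨_, _, hsub w 0 hw le_rfl (add_zero w), hlub.1 ⟨w, 0, hw, le_rfl, add_zero w, rfl⟩, rfl⟩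
    (by
      rintro _ ⟨z, hz, hzB, rfl⟩ _ ⟨z', hz', hzB', rfl⟩
      exact ⟨_, ⟨_, hsup z hz z' hz', sup_le hzB hzB', rfl⟩,
        sub_le_sub_left le_sup_left _, sub_le_sub_left le_sup_right _⟩)
    (by
      constructor
      · rintro _ ⟨z, -, hzB, rfl⟩
        exact sub_nonneg.2 hzB
      · intro d hd
        have : |B| w ≤ |B| w - d := hlub.2 (by
          rintro _ ⟨u, v, hu, hv, huv, rfl⟩
          exact le_sub_comm.1
            (hd ⟨_, hsub u v hu hv huv, hlub.1 ⟨u, v, hu, hv, huv, rfl⟩, rfl⟩))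
        exact (le_sub_self_iff _).1 this)
    ε hε
  refine ⟨ψ z, hz ψ hψ, ?_⟩
  rw [Real.dist_eq, ← map_sub]
  exact (hψn _).trans_lt hzε

end TwoSidedMultiplicationModulus

/-- Divide by one positive factor at a time. Neither boundedness nor nonemptiness is needed, as
`Real.sSup_le` asks only for a nonnegative bound. -/
theorem Real.sSup_mul_sSup_le {s t : Set ℝ} {m : ℝ} (hs : ∀ a ∈ s, 0 ≤ a) (ht : ∀ b ∈ t, 0 ≤ b)
    (hm : 0 ≤ m) (h : ∀ a ∈ s, ∀ b ∈ t, a * b ≤ m) : sSup s * sSup t ≤ m := by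
  have h1 : ∀ b ∈ t, sSup s * b ≤ m := fun b hb => by
    rcases (ht b hb).eq_or_lt with rfl | hb0
    · rwa [mul_zero]
    · exact (le_div_iff₀ hb0).1 (Real.sSup_le (fun a ha => (le_div_iff₀ hb0).2 (h a ha b hb))
        (div_nonneg hm hb0.le))
  rcases (Real.sSup_nonneg hs).eq_or_lt with h0 | h0
  · rwa [← h0, zero_mul]
  · exact (le_div_iff₀' h0).1 (Real.sSup_le (fun b hb => (le_div_iff₀' h0).2 (h1 b hb))
      (div_nonneg hm h0.le))

/-! ### The norm of `M_{A,B}` -/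

section NormOfTwoSidedMultiplication

open RegularOperator

variable {W X Y Z : Type*}
    [NormedAddCommGroup W] [Lattice W] [HasSolidNorm W] [IsOrderedAddMonoid W]
    [NormedSpace ℝ W] [IsOrderedModule ℝ W] [CompleteSpace W]
    [NormedAddCommGroup X] [Lattice X] [HasSolidNorm X] [IsOrderedAddMonoid X]
    [NormedSpace ℝ X] [IsOrderedModule ℝ X] [CompleteSpace X]
    [NormedAddCommGroup Y] [Lattice Y] [HasSolidNorm Y] [IsOrderedAddMonoid Y]
    [NormedSpace ℝ Y] [IsOrderedModule ℝ Y] [DedekindComplete Y]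
    [NormedAddCommGroup Z] [Lattice Z] [HasSolidNorm Z] [IsOrderedAddMonoid Z]
    [NormedSpace ℝ Z] [IsOrderedModule ℝ Z] [DedekindComplete Z]

theorem le_mul_of_mem_modulusNorms_twoSidedMul [CompleteSpace Y] [DedekindComplete X]
    (A : RegularOperator Y Z) (B : RegularOperator W X) {r : ℝ}
    (hr : r ∈ (twoSidedMul A B :
      RegularOperator (RegularOperator X Y) (RegularOperator W Z)).modulusNorms) :
    r ≤ ‖A‖ * ‖B‖ := by
  obtain ⟨T, hT, rfl⟩ := hr
  have hAB := mul_nonneg A.regularNorm_nonneg B.regularNorm_nonneg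
  -- The value at `T` is itself a regular norm, hence a supremum over `w`.
  refine Real.sSup_le ?_ hAB
  rintro _ ⟨w, hw, rfl⟩
  have hpos := isPositiveOperator_abs (twoSidedMul (X := X) (Y := Y) A B)
  have hle : |(|(twoSidedMul A B)| T)| ≤ twoSidedMul |A| |B| |T| :=
    (hpos.abs_apply_le T).trans (abs_twoSidedMul_le A B |T| (abs_nonneg T))
  have hlew : |(|(|(twoSidedMul A B)| T)| w)| ≤ |A| (|T| (|B| |w|)) :=
    ((isPositiveOperator_abs _).abs_apply_le w).trans (hle |w| (abs_nonneg w))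
  calc ‖|(|(twoSidedMul A B)| T)| w‖ ≤ ‖|A| (|T| (|B| |w|))‖ :=
        norm_le_norm_of_abs_le_abs (hlew.trans (le_abs_self _))
    _ ≤ ‖A‖ * (‖T‖ * (‖B‖ * ‖w‖)) := by
      refine (A.norm_abs_apply_le _).trans (mul_le_mul_of_nonneg_left ?_ A.regularNorm_nonneg)
      refine (T.norm_abs_apply_le _).trans (mul_le_mul_of_nonneg_left ?_ T.regularNorm_nonneg)
      refine (B.norm_abs_apply_le _).trans_eq ?_
      rw [norm_abs_eq_norm]
    _ ≤ ‖A‖ * (1 * (‖B‖ * 1)) := by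
      have := A.regularNorm_nonneg
      have := B.regularNorm_nonneg
      gcongr
    _ = ‖A‖ * ‖B‖ := by ring

/-- The test operator is `ψ ⊗ y` with `ψ` norming `|B| w`; it lies in the unit ball of the regular
norm, and the rank one estimate applies with `N = |M_{A,B}|`. -/
theorem mul_norm_le_norm_twoSidedMul [OrderContinuousNorm X]
    (A : RegularOperator Y Z) (B : RegularOperator W X)
    (hM : BddAbove (twoSidedMul A B :
      RegularOperator (RegularOperator X Y) (RegularOperator W Z)).modulusNorms)
    {y : Y} (hy : 0 ≤ y) (hy1 : ‖y‖ ≤ 1) {w : W} (hw : 0 ≤ w) (hw1 : ‖w‖ ≤ 1) :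
    ‖|A| y‖ * ‖|B| w‖ ≤
      ‖(twoSidedMul A B : RegularOperator (RegularOperator X Y) (RegularOperator W Z))‖ := by
  obtain ⟨ψ, hψ, hψn, hψB⟩ := exists_functional_norming (isPositiveOperator_abs B w hw)
  set T : RegularOperator X Y := rankOne ψ hψ y with hTdef
  have hT0 : 0 ≤ T := rankOne_nonneg hψ hy
  have hT1 : ‖T‖ ≤ 1 := by
    refine Real.sSup_le ?_ zero_le_one
    rintro _ ⟨x, hx, rfl⟩
    rw [abs_of_nonneg hT0, hTdef, rankOne_apply, norm_smul, Real.norm_eq_abs]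
    exact mul_le_one₀ ((hψn x).trans hx) (norm_nonneg _) hy1
  set R := |(twoSidedMul A B :
    RegularOperator (RegularOperator X Y) (RegularOperator W Z))| T with hR
  have hR0 : 0 ≤ R := isPositiveOperator_abs (twoSidedMul A B) T hT0
  have h := smul_abs_apply_le_of_abs_twoSidedMul_le (le_refl |twoSidedMul A B|) hψ hψn hy hw
  calc ‖|A| y‖ * ‖|B| w‖ = ‖ψ (|B| w) • |A| y‖ := by
        rw [hψB, norm_smul, norm_norm, mul_comm]
    _ ≤ ‖R w‖ := norm_le_norm_of_abs_le_abs (by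
        rw [abs_of_nonneg (smul_nonneg (hψB ▸ norm_nonneg _) (isPositiveOperator_abs A y hy))]
        exact h.trans (le_abs_self _))
    _ ≤ ‖R‖ * ‖w‖ := by simpa only [abs_of_nonneg hR0] using R.norm_abs_apply_le w
    _ ≤ ‖R‖ := mul_le_of_le_one_right R.regularNorm_nonneg hw1
    _ ≤ _ := le_csSup hM ⟨T, hT1, rfl⟩

end NormOfTwoSidedMultiplication

theorem corollary2p3 {W X Y Z : Type*}
    [NormedAddCommGroup W] [Lattice W] [HasSolidNorm W] [IsOrderedAddMonoid W]
    [NormedSpace ℝ W] [IsOrderedModule ℝ W] [CompleteSpace W]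
    [NormedAddCommGroup X] [Lattice X] [HasSolidNorm X] [IsOrderedAddMonoid X]
    [NormedSpace ℝ X] [IsOrderedModule ℝ X] [CompleteSpace X] [OrderContinuousNorm X]
    [NormedAddCommGroup Y] [Lattice Y] [HasSolidNorm Y] [IsOrderedAddMonoid Y]
    [NormedSpace ℝ Y] [IsOrderedModule ℝ Y] [CompleteSpace Y] [OrderContinuousNorm Y]
    [NormedAddCommGroup Z] [Lattice Z] [HasSolidNorm Z] [IsOrderedAddMonoid Z]
    [NormedSpace ℝ Z] [IsOrderedModule ℝ Z] [CompleteSpace Z] [DedekindComplete Z]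
    (A : RegularOperator Y Z) (B : RegularOperator W X) :
    BddAbove A.modulusNorms ∧ BddAbove B.modulusNorms ∧
      BddAbove (twoSidedMul A B : RegularOperator (RegularOperator X Y)
        (RegularOperator W Z)).modulusNorms ∧
      ‖(twoSidedMul A B : RegularOperator (RegularOperator X Y) (RegularOperator W Z))‖ =
        ‖A‖ * ‖B‖ := by
  -- Finiteness here comes from the explicit bound `‖A‖ * ‖B‖`, not from completeness of `L^r(X,
  -- Y)`.
  have hM : BddAbove (twoSidedMul A B : RegularOperator (RegularOperator X Y)
      (RegularOperator W Z)).modulusNorms :=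
    ⟨_, fun _ => le_mul_of_mem_modulusNorms_twoSidedMul A B⟩
  refine ⟨A.bddAbove_modulusNorms, B.bddAbove_modulusNorms, hM, le_antisymm ?_ ?_⟩
  · exact Real.sSup_le (fun _ => le_mul_of_mem_modulusNorms_twoSidedMul A B)
      (mul_nonneg A.regularNorm_nonneg B.regularNorm_nonneg)
  · refine Real.sSup_mul_sSup_le ?_ ?_ (Real.sSup_nonneg ?_) ?_
    · rintro _ ⟨y, -, rfl⟩
      exact norm_nonneg _
    · rintro _ ⟨w, -, rfl⟩
      exact norm_nonneg _
    · rintro _ ⟨T, -, rfl⟩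
      exact RegularOperator.regularNorm_nonneg _
    · rintro _ ⟨y, hy, rfl⟩ _ ⟨w, hw, rfl⟩
      -- Passing to `|y|` and `|w|` keeps the norms and reduces to positive vectors.
      refine (mul_le_mul (A.norm_abs_apply_le_norm_abs_apply_abs y)
        (B.norm_abs_apply_le_norm_abs_apply_abs w) (norm_nonneg _) (norm_nonneg _)).trans ?_
      exact mul_norm_le_norm_twoSidedMul A B hM (abs_nonneg y) (by rwa [norm_abs_eq_norm])
        (abs_nonneg w) (by rwa [norm_abs_eq_norm])
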